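/- Let $G$ be a finite group. **Smooth parallel repetition.** A Max-TSA instance consists of $n$ Boolean variables and $m\ge 1$ constraints; the $j$-th constraint requires $x_1+x_2+x_3+x_4x_5=b_j \pmod 2$ for an ordered list of five distinct variables. For integers $1<t<r$, its $(r,t)$-smooth UFG Label Cover $\Lambda_{UFG}$ is the following two-prover game. The verifier picks $r$ constraints $w=(C_{i_1},\dots,C_{i_r})$ (uniformly, with repetition), a uniform set of $t$ of the $r$ positions, and a uniform variable of the constraint at each of these $t$ positions. The question $w\in W$ goes to the first prover. The question $v\in V$, which consists of the $t$ chosen positions with the chosen variables, and of the constraints at the remaining $r-t$ positions, goes to the second prover. The edge set $E$ consists of the resulting pairs $e=(v,w)$. The labels in $[R]$ are the assignments to the $5r$ variables of $w$, those in $[L]$ are the assignments to the $t+5(r-t)$ variables of $v$, and $\pi_e:[R]\to[L]$ is the restriction. For $\ell\in[R]$ let $\mathscr p_j(\ell)\in\{0,1\}$ be the value of $x_1+x_2+x_3+x_4x_5$ on the $j$-th block of $\ell$, and put $I_w(j)=i_j$. A labelling $\sigma_V:V\to[L]$, $\sigma_W:W\to[R]$ satisfies $e=(v,w)$ if $\pi_e(\sigma_W(w))=\sigma_V(v)$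 and $\mathscr p_j(\sigma_W(w))=b_{I_w(j)}$ for all $j\in[r]$. $\mathrm{Opt}(\Lambda_{UFG})$ is the largest fraction of edges that a labelling satisfies. **The Max-3-Lin instance.** A Max-3-Lin instance over $G$ is a probability distribution on constraints of the form $x_1x_2x_3=g$, where $x_1,x_2,x_3$ are variables with values in $G$ and $g\in G$; its $\mathrm{Opt}$ is the largest probability with which an assignment satisfies a random constraint. On $G^R$ let $\mathbf x\sim\mathbf x'$ if there is $F:\{0,1\}^r\to G$ with $x_d=F(\mathscr p_1(d),\dots,\mathscr p_r(d))\,x'_d$ for all $d\in[R]$. On $G^L$ let $\mathbf y\sim\mathbf y'$ if $\mathbf y=\mathbf y'c$ (coordinatewise) for some $c\in G$. Fix a representative $\bar{\mathbf x}$, $\bar{\mathbf y}$ in each class. Let $0<\varepsilon\le 1$. The instance $I$ has as variables the values $f_w^F(\bar{\mathbf x})$ and $f_w(\mathbf z)$ (for $w\in W$) and $f_v^F(\bar{\mathbf y})$ (for $v\in V$), where $\mathbf z\in G^R$ and $\bar{\mathbf x},\bar{\mathbf y}$ range over the representatives. A random constraint is drawn as follows: pick $e=(v,w)\in E$, $\mathbf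 x\in G^R$, $\mathbf y\in G^L$ uniformly and independently; let $z_d=x_d^{-1}\,\eta_d\,y_{\pi_e(d)}^{-1}$, where the $\eta_d$ are independent, each equal to $1$ with probability $1-\varepsilon$ and uniform in $G$ with probability $\varepsilon$; write $x_d=F(\mathscr p_1(d),\dots,\mathscr p_r(d))\,\bar x_d$ and $\mathbf y=\bar{\mathbf y}c$; the constraint is $$f_w^F(\bar{\mathbf x})\,f_w(\mathbf z)\,f_v^F(\bar{\mathbf y})=F(b_{I_w(1)},\dots,b_{I_w(r)})^{-1}c^{-1}.$$ (This is the test $f_w^F(\mathbf x)f_w(\mathbf z)f_v^F(\mathbf y)=1_G$ for $f_w^F$ functionally folded, $f_w$ unfolded and $f_v^F$ classically folded.) **Theorem.** Let $0<\varepsilon\le1$, $\delta>0$, $\zeta=\log(2|G|^3/\delta)/\varepsilon$, and let $1<t<r$ be integers with $$\frac tr\le\frac{\delta^2}{4|G|^6\zeta^2}.$$ Let $\Lambda_{UFG}$ be the $(r,t)$-smooth UFG Label Cover of any Max-TSA instance, and let $I$ be the Max-3-Lin instance over $G$ produced from it as above. Then: * Completeness: if $\mathrm{Opt}(\Lambda_{UFG})=1$,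 then $\mathrm{Opt}(I)\ge1-\varepsilon$. * Soundness: if $\mathrm{Opt}(\Lambda_{UFG})\le\dfrac{\delta^4}{32|G|^{12}}\,\zeta^{-1}$, then $\mathrm{Opt}(I)\le\dfrac1{|G|}+\delta$. -/

import Mathlib

namespace UFG

/-! ### Label Cover and UFG Label Cover -/

/-- A Label Cover instance with vertex sets `V`, `W`, (non-empty) edge set `E` and alphabets `L`
(for `V`) and `R` (for `W`).  Edges are indexed by the type `E`; an edge is determined by its
two end points. -/
structure LabelCover (V W E L R : Type*) where
  left : E → V
  right : E → W
  edge_injective : Function.Injective fun e => (left e, right e)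
  edge_nonempty : Nonempty E
  proj : E → R → L

/-- A UFG Label Cover instance: a Label Cover instance together with functions
`p 1, …, p r : R → {0,1}`, a vector `b ∈ {0,1}^m`, and index functions `idx w : [r] → [m]`. -/
structure UFGLabelCover (V W E L R : Type*) (r m : ℕ) extends LabelCover V W E L R where
  p : Fin r → R → ZMod 2
  b : Fin m → ZMod 2
  idx : W → Fin r → Fin m

namespace UFGLabelCover

variable {V W E L R : Type*} {r m : ℕ}

/-- The edge `e = (v, w)` is satisfied by `(σL, σR)`: the projection constraint holds and
the label of `w` satisfies the `r` side conditions. -/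
def Satisfies (Λ : UFGLabelCover V W E L R r m) (σL : V → L) (σR : W → R) (e : E) : Prop :=
  Λ.proj e (σR (Λ.right e)) = σL (Λ.left e) ∧
    ∀ i : Fin r, Λ.p i (σR (Λ.right e)) = Λ.b (Λ.idx (Λ.right e) i)

open Classical in
/-- The fraction of edges satisfied by `(σL, σR)`. -/
noncomputable def value [Fintype E] (Λ : UFGLabelCover V W E L R r m)
    (σL : V → L) (σR : W → R) : ℝ :=
  ((Finset.univ.filter fun e => Λ.Satisfies σL σR e).card : ℝ) / (Fintype.card E : ℝ)

/-- The optimal value. -/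
noncomputable def opt [Fintype E] (Λ : UFGLabelCover V W E L R r m) : ℝ :=
  ⨆ σ : (V → L) × (W → R), Λ.value σ.1 σ.2

end UFGLabelCover

/-! ### Max-TSA and smooth parallel repetition -/

/-- The Tri-Sum-And function `x₁ + x₂ + x₃ + x₄ x₅` over `{0,1}`. -/
def tsa (x : Fin 5 → ZMod 2) : ZMod 2 := x 0 + x 1 + x 2 + x 3 * x 4

/-- A Max-TSA instance with variables `Fin n` and constraints `Fin m`: the `j`-th constraint
requires `tsa` of the five distinct variables in `scope j` to be equal to `b j`. -/
structure MaxTSA (n m : ℕ) where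
  scope : Fin m → Fin 5 ↪ Fin n
  b : Fin m → ZMod 2

/-- The possible choices of `t` among `r` positions. -/
abbrev Positions (r t : ℕ) : Type := {T : Finset (Fin r) // T.card = t}

namespace Positions

variable {r t : ℕ}

/-- The `k`-th chosen position. -/
def chosen (T : Positions r t) : Fin t → Fin r := T.1.orderEmbOfFin T.2

/-- The `k`-th position that has not been chosen. -/
def rest (T : Positions r t) : Fin (r - t) → Fin r :=
  T.1ᶜ.orderEmbOfFin (by rw [Finset.card_compl, T.2, Fintype.card_fin])

end Positions

/-- Questions to the first prover: `r` constraints. -/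
abbrev RightVertex (m r : ℕ) : Type := Fin r → Fin m

/-- Questions to the second prover: a variable at each of `t` positions, and a constraint at
each of the remaining `r - t` positions. -/
abbrev LeftVertex (n m r t : ℕ) : Type :=
  Positions r t × (Fin t → Fin n) × (Fin (r - t) → Fin m)

/-- The choices of the verifier: `r` constraints, `t` of their positions, and one of the five
variables of the constraint at each chosen position. -/
abbrev SmoothEdge (m r t : ℕ) : Type :=
  RightVertex m r × Positions r t × (Fin t → Fin 5)

/-- Answers of the first prover: an assignment to the `5 r` variables of the `r` constraints. -/
abbrev RightLabel (r : ℕ) : Type := Fin r → Fin 5 → ZMod 2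

/-- Answers of the second prover: an assignment to the `t` variables and to the `5 (r - t)`
variables of the `r - t` constraints. -/
abbrev LeftLabel (r t : ℕ) : Type := (Fin t → ZMod 2) × (Fin (r - t) → Fin 5 → ZMod 2)

/-- The question to the second prover that results from the choices of the verifier. -/
def MaxTSA.leftQuestion {n m : ℕ} (Φ : MaxTSA n m) {r t : ℕ} (e : SmoothEdge m r t) :
    LeftVertex n m r t :=
  (e.2.1, fun k => Φ.scope (e.1 (e.2.1.chosen k)) (e.2.2 k), fun k => e.1 (e.2.1.rest k))

/-- The `(r, t)`-smooth UFG Label Cover obtained from a Max-TSA instance by smooth parallel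
repetition. -/
def MaxTSA.smoothRepetition {n m : ℕ} (Φ : MaxTSA n m) (hm : 0 < m) {r t : ℕ} (htr : t ≤ r) :
    UFGLabelCover (LeftVertex n m r t) (RightVertex m r) (SmoothEdge m r t)
      (LeftLabel r t) (RightLabel r) r m where
  left := Φ.leftQuestion
  right e := e.1
  edge_injective := by
    rintro ⟨w, T, c⟩ ⟨w', T', c'⟩ h
    simp only [MaxTSA.leftQuestion, Prod.mk.injEq] at h
    obtain ⟨⟨rfl, h, -⟩, rfl⟩ := h
    have hc : c = c' := by
      funext k
      exact (Φ.scope _).injective (congrFun h k)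
    rw [hc]
  edge_nonempty := by
    obtain ⟨T, -, hT⟩ := Finset.exists_subset_card_eq
      (s := (Finset.univ : Finset (Fin r))) (n := t) (by simpa using htr)
    exact ⟨(fun _ => ⟨0, hm⟩, ⟨T, hT⟩, fun _ => 0)⟩
  proj e ℓ := (fun k => ℓ (e.2.1.chosen k) (e.2.2 k), fun k => ℓ (e.2.1.rest k))
  p j ℓ := tsa (ℓ j)
  b := Φ.b
  idx w := w

/-! ### Max-3-Lin -/

/-- A Max-3-Lin instance over `G` with variables `X`, given as a probability distribution on
constraints: the constraint `c` has probability `weight c` and reads `x₁ x₂ x₃ = rhs c`, where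
`x₁, x₂, x₃` are the variables listed in `scope c`. -/
structure MaxThreeLin (G X C : Type*) [Fintype C] where
  weight : C → ℝ
  weight_nonneg : ∀ c, 0 ≤ weight c
  weight_sum : ∑ c, weight c = 1
  scope : C → Fin 3 → X
  rhs : C → G

namespace MaxThreeLin

variable {G X C : Type*} [Group G] [Fintype C]

open Classical in
/-- The probability that a random constraint is satisfied by the assignment `A`. -/
noncomputable def value (I : MaxThreeLin G X C) (A : X → G) : ℝ :=
  ∑ c, if A (I.scope c 0) * A (I.scope c 1) * A (I.scope c 2) = I.rhs c then I.weight c else 0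

/-- The optimal value. -/
noncomputable def opt (I : MaxThreeLin G X C) : ℝ := ⨆ A : X → G, I.value A

end MaxThreeLin

/-! ### Folding -/

/-- The equivalence relation of functional folding: `x ∼ y` if there is `F : {0,1}^r → G` with
`x_d = F (p₁(d), …, p_r(d)) y_d` for all `d`. -/
def functionalSetoid (G : Type*) [Group G] {R : Type*} {r : ℕ} (p : Fin r → R → ZMod 2) :
    Setoid (R → G) where
  r x y := ∃ F : (Fin r → ZMod 2) → G, ∀ d, x d = F (fun i => p i d) * y d
  iseqv :=
    { refl := fun _ => ⟨fun _ => 1, fun _ => (one_mul _).symm⟩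
      symm := fun ⟨F, hF⟩ => ⟨fun a => (F a)⁻¹, fun d => by rw [hF d, inv_mul_cancel_left]⟩
      trans := fun ⟨F, hF⟩ ⟨F', hF'⟩ =>
        ⟨fun a => F a * F' a, fun d => by rw [hF d, hF' d, mul_assoc]⟩ }

/-- The equivalence relation of classical folding: `x ∼ y` if `x = y c` for some `c ∈ G`. -/
def classicalSetoid (G : Type*) [Group G] (L : Type*) : Setoid (L → G) where
  r x y := ∃ c : G, ∀ d, x d = y d * c
  iseqv :=
    { refl := fun _ => ⟨1, fun _ => (mul_one _).symm⟩
      symm := fun ⟨c, hc⟩ => ⟨c⁻¹, fun d => by rw [hc d, mul_inv_cancel_right]⟩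
      trans := fun ⟨c, hc⟩ ⟨c', hc'⟩ => ⟨c' * c, fun d => by rw [hc d, hc' d, mul_assoc]⟩ }

/-- Every `x` is equivalent to the fixed representative of its class. -/
theorem functional_out {G : Type*} [Group G] {R : Type*} {r : ℕ} (p : Fin r → R → ZMod 2)
    (x : R → G) : ∃ F : (Fin r → ZMod 2) → G, ∀ d,
      x d = F (fun i => p i d) * (Quotient.mk (functionalSetoid G p) x).out d :=
  (functionalSetoid G p).symm (@Quotient.mk_out _ (functionalSetoid G p) x)

/-- Every `y` is equivalent to the fixed representative of its class. -/
theorem classical_out {G : Type*} [Group G] {L : Type*} (y : L → G) :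
    ∃ c : G, ∀ d, y d = (Quotient.mk (classicalSetoid G L) y).out d * c :=
  (classicalSetoid G L).symm (@Quotient.mk_out _ (classicalSetoid G L) y)

/-- The function `F` with `x_d = F (p₁(d), …, p_r(d)) x̄_d`, where `x̄` is the fixed
representative of the class of `x`. -/
noncomputable def functionalFactor {G : Type*} [Group G] {R : Type*} {r : ℕ}
    (p : Fin r → R → ZMod 2) (x : R → G) : (Fin r → ZMod 2) → G :=
  Classical.choose (functional_out p x)

/-- The element `c` with `y = ȳ c`, where `ȳ` is the fixed representative of the class
of `y`. -/
noncomputable def classicalFactor {G : Type*} [Group G] {L : Type*} (y : L → G) : G :=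
  Classical.choose (classical_out y)

/-! ### The test -/

/-- The variables of the Max-3-Lin instance: the entries of the tables that are queried.  Of the
functionally folded table of `w` and of the classically folded table of `v` only the entries at the
fixed representatives are stored, that is, one entry for each equivalence class. -/
inductive Query (V W L R G : Type*) [Group G] {r : ℕ} (p : Fin r → R → ZMod 2)
  | functional (w : W) (x : Quotient (functionalSetoid G p))
  | unfolded (w : W) (z : R → G)
  | classical (v : V) (y : Quotient (classicalSetoid G L))

open Classical in
/-- The law of one coordinate of the noise: it is `1` with probability `1 - ε`, and uniform
in `G` with probability `ε`. -/
noncomputable def noise {G : Type*} [Group G] [Fintype G] (ε : ℝ) (g : G) : ℝ :=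
  (1 - ε) * (if g = 1 then 1 else 0) + ε / (Fintype.card G : ℝ)

theorem noise_nonneg {G : Type*} [Group G] [Fintype G] {ε : ℝ} (h0 : 0 ≤ ε) (h1 : ε ≤ 1)
    (g : G) : 0 ≤ noise ε g := by
  have : 0 ≤ 1 - ε := by linarith
  unfold noise
  positivity

theorem noise_sum {G : Type*} [Group G] [Fintype G] (ε : ℝ) : ∑ g : G, noise ε g = 1 := by
  classical
  have : (Fintype.card G : ℝ) ≠ 0 := Nat.cast_ne_zero.mpr Fintype.card_ne_zero
  simp only [noise, Finset.sum_add_distrib, ← Finset.mul_sum, Finset.sum_ite_eq',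
    Finset.mem_univ, if_true, Finset.sum_const, Finset.card_univ, nsmul_eq_mul]
  field_simp
  ring

namespace UFGLabelCover

variable {V W E L R : Type*} {r m : ℕ}

/-- The random choices of the test: an edge `e`, `x ∈ G^R`, `y ∈ G^L` and the noise
`η ∈ G^R`. -/
abbrev Sample (E L R G : Type*) : Type _ := E × (R → G) × (L → G) × (R → G)

/-- The Max-3-Lin instance of the test.  With `e = (v, w)` uniform in `E`, `x` uniform in `G^R`,
`y` uniform in `G^L`, the coordinates `η_d` independent with law `noise ε`, and
`z_d = x_d⁻¹ η_d (y_{π_e(d)})⁻¹`, the test is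
`f_w^F(x) f_w(z) f_v^F(y) = 1`, where `f_w^F(x) = F(b_{I_w(1)}, …, b_{I_w(r)}) f_w^F(x̄)` and
`f_v^F(y) = f_v^F(ȳ) c`; in terms of the queried entries this is
`f_w^F(x̄) f_w(z) f_v^F(ȳ) = F(b_{I_w(1)}, …, b_{I_w(r)})⁻¹ c⁻¹`. -/
noncomputable def test [Fintype E] [Fintype L] [DecidableEq L] [Fintype R] [DecidableEq R]
    (Λ : UFGLabelCover V W E L R r m) (G : Type*) [Group G] [Fintype G]
    (ε : ℝ) (h0 : 0 ≤ ε) (h1 : ε ≤ 1) :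
    MaxThreeLin G (Query V W L R G Λ.p) (Sample E L R G) where
  weight := fun (_, _, _, η) =>
    (Fintype.card E : ℝ)⁻¹ * (Fintype.card (R → G) : ℝ)⁻¹ * (Fintype.card (L → G) : ℝ)⁻¹ *
      ∏ d, noise ε (η d)
  weight_nonneg := fun (_, _, _, η) =>
    mul_nonneg (by positivity) (Finset.prod_nonneg fun d _ => noise_nonneg h0 h1 (η d))
  weight_sum := by
    have hE : (Fintype.card E : ℝ) ≠ 0 := by
      have := Λ.edge_nonempty
      exact Nat.cast_ne_zero.mpr Fintype.card_ne_zero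
    have hR : (Fintype.card (R → G) : ℝ) ≠ 0 := Nat.cast_ne_zero.mpr Fintype.card_ne_zero
    have hL : (Fintype.card (L → G) : ℝ) ≠ 0 := Nat.cast_ne_zero.mpr Fintype.card_ne_zero
    have hη : ∑ η : R → G, ∏ d, noise ε (η d) = 1 := by
      rw [← Fintype.prod_sum (fun (_ : R) (g : G) => noise ε g)]
      simp [noise_sum]
    simp only [Fintype.sum_prod_type, ← Finset.mul_sum, hη, Finset.sum_const, Finset.card_univ,
      nsmul_eq_mul]
    field_simp
  scope := fun (e, x, y, η) =>
    ![Query.functional (Λ.right e) (Quotient.mk _ x),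
      Query.unfolded (Λ.right e) (fun d => (x d)⁻¹ * η d * (y (Λ.proj e d))⁻¹),
      Query.classical (Λ.left e) (Quotient.mk _ y)]
  rhs := fun (e, x, y, _) =>
    (functionalFactor Λ.p x (fun i => Λ.b (Λ.idx (Λ.right e) i)))⁻¹ * (classicalFactor y)⁻¹

end UFGLabelCover

end UFG

namespace UFG

open scoped BigOperators

open Finset (expect_congr expect_comm mul_expect expect_mul expect_add_distrib)

/-! ### Averages over finite groups and product spaces -/

section Averages

variable {G : Type*} [Group G] [Fintype G]

/-! Soundness uses no representation theory of `G`: Fourier analysis is replaced by the Efron–Stein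
decomposition of real functions on a power of `G`, whose projections are convolutions with products
of the class function `|G|·1[g = 1] - 1`. The indicator of `fgh = 1` is `1/|G|` plus a sum of `|G|²`
products of bounded real tables (`indicator_mul_mul_eq_one`). The noise acts diagonally on the
decomposition, so each product contributes a sum over sets `S` of labels of `w`, weighted by `(1 -
ε)^|S|` (`expect_noise_eq_sum_correlation`).

Noise damps the sets with `|S| > ζ`. Functional folding kills every `S` without a label meeting the
side conditions (`energy_centredIndicator_functionalTable`); in any other `S` such a label `d₀` is
fixed. For small `S`, smoothness makes it unlikely that another label of `S` projects to `π d₀`. If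
none does, only components of the table of `v` that depend on `π d₀` and have degree at most `|S|`
survive, and Cauchy–Schwarz gives the square root of a low-degree influence. These influences sum to
at most `ζ`, so the provers can decode: the first samples `S` by energy and answers `d₀`, the second
samples a label by influence. The error per product is at most `ρ + ζτ + √(ζ Opt)`
(`expect_sum_correlation_le`).

For completeness, the tables are the dictators of a perfect labelling; the test can fail only if the
noise moves one fixed coordinate. -/

theorem expect_mul_left (a : G) (f : G → ℝ) : 𝔼 x, f (a * x) = 𝔼 x, f x :=
  Fintype.expect_equiv (Equiv.mulLeft a) _ _ fun _ => rfl

theorem expect_mul_right (a : G) (f : G → ℝ) : 𝔼 x, f (x * a) = 𝔼 x, f x :=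
  Fintype.expect_equiv (Equiv.mulRight a) _ _ fun _ => rfl

theorem expect_inv (f : G → ℝ) : 𝔼 x, f x⁻¹ = 𝔼 x, f x :=
  Fintype.expect_equiv (Equiv.inv G) _ _ fun _ => rfl

theorem expect_pi_prod {ι Ω : Type*} [Fintype ι] [DecidableEq ι] [Fintype Ω]
    (φ : ι → Ω → ℝ) : 𝔼 x : ι → Ω, ∏ i, φ i (x i) = ∏ i, 𝔼 a, φ i a := by
  simp only [Fintype.expect_eq_sum_div_card, Finset.prod_div_distrib, Fintype.prod_sum]
  simp

theorem abs_expect_mul_le_sqrt {α : Type*} [Fintype α] (f g : α → ℝ) :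
    |𝔼 x, f x * g x| ≤ √(𝔼 x, f x ^ 2) * √(𝔼 x, g x ^ 2) := by
  rw [← Real.sqrt_mul (Finset.expect_nonneg fun _ _ => sq_nonneg _)]
  exact Real.abs_le_sqrt (Finset.expect_mul_sq_le_sq_mul_sq _ _ _)

end Averages

/-! ### The Efron–Stein decomposition on a power of a finite group -/

section EfronStein

variable {G : Type*} [Group G] [Fintype G]

open Classical in
/-- The kernel `|G| · 1[g = 1] - 1` of the projection onto the functions of mean zero. -/
noncomputable def meanZeroKernel (g : G) : ℝ :=
  (Fintype.card G : ℝ) * (if g = 1 then 1 else 0) - 1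

/-- Being a class function is what stands in for commutativity of `G`. -/
theorem meanZeroKernel_mul_comm (a b : G) :
    meanZeroKernel (a * b) = meanZeroKernel (b * a) := by
  unfold meanZeroKernel
  have : a * b = 1 ↔ b * a = 1 := by rw [mul_eq_one_iff_eq_inv, mul_eq_one_iff_inv_eq, eq_comm]
  by_cases h : b * a = 1 <;> simp [h, this]

theorem meanZeroKernel_inv (a : G) : meanZeroKernel a⁻¹ = meanZeroKernel a := by
  unfold meanZeroKernel
  by_cases h : a = 1 <;> simp [h]

theorem expect_meanZeroKernel : 𝔼 g : G, meanZeroKernel g = 0 := by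
  classical
  have : (Fintype.card G : ℝ) ≠ 0 := Nat.cast_ne_zero.mpr Fintype.card_ne_zero
  simp only [meanZeroKernel, Finset.expect_sub_distrib, ← mul_expect,
    Fintype.expect_eq_sum_div_card, Finset.sum_ite_eq', Finset.mem_univ, if_true]
  simp [this]

theorem expect_meanZeroKernel_mul_left (a : G) : 𝔼 g : G, meanZeroKernel (a * g) = 0 := by
  rw [expect_mul_left a meanZeroKernel, expect_meanZeroKernel]

theorem expect_meanZeroKernel_inv_mul (a : G) : 𝔼 g : G, meanZeroKernel (g⁻¹ * a) = 0 := by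
  rw [expect_inv (fun g => meanZeroKernel (g * a)), expect_mul_right a meanZeroKernel,
    expect_meanZeroKernel]

/-- A projection kernel is idempotent under convolution. -/
theorem expect_meanZeroKernel_mul_meanZeroKernel (a b : G) :
    𝔼 g : G, meanZeroKernel (a * g) * meanZeroKernel (g⁻¹ * b) = meanZeroKernel (a * b) := by
  classical
  have hG : (Fintype.card G : ℝ) ≠ 0 := Nat.cast_ne_zero.mpr Fintype.card_ne_zero
  have h (g : G) : meanZeroKernel (a * g) * meanZeroKernel (g⁻¹ * b) =
      (Fintype.card G : ℝ) * (if g = a⁻¹ then meanZeroKernel (g⁻¹ * b) else 0) -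
        meanZeroKernel (g⁻¹ * b) := by
    conv_lhs => rw [meanZeroKernel]
    simp only [mul_eq_one_iff_inv_eq, eq_comm (a := a⁻¹), sub_mul, one_mul, mul_assoc, ite_mul,
      zero_mul]
  simp only [h, Finset.expect_sub_distrib, expect_meanZeroKernel_inv_mul, sub_zero,
    ← mul_expect]
  simp [NNRat.smul_def, hG]

variable {ι : Type*}

/-- The kernel of the projection onto the Efron–Stein component indexed by `S`. -/
noncomputable def kernel (S : Finset ι) (x : ι → G) : ℝ := ∏ d ∈ S, meanZeroKernel (x d)

theorem kernel_mul_comm (S : Finset ι) (x y : ι → G) : kernel S (x * y) = kernel S (y * x) :=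
  Finset.prod_congr rfl fun _ _ => meanZeroKernel_mul_comm _ _

theorem kernel_inv (S : Finset ι) (x : ι → G) : kernel S x⁻¹ = kernel S x :=
  Finset.prod_congr rfl fun _ _ => meanZeroKernel_inv _

variable [Fintype ι]

theorem sum_pow_card_mul_kernel (c : ℝ) (x : ι → G) :
    ∑ S : Finset ι, c ^ S.card * kernel S x = ∏ d, (1 + c * meanZeroKernel (x d)) := by
  rw [Finset.prod_one_add, Finset.powerset_univ]
  simp [kernel, Finset.prod_mul_distrib]

variable [DecidableEq ι]

theorem kernel_eq_prod_ite (S : Finset ι) (x : ι → G) :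
    kernel S x = ∏ d, if d ∈ S then meanZeroKernel (x d) else 1 := by
  rw [kernel, Finset.prod_ite_mem, Finset.univ_inter]

/-- Each coordinate has density `1 + (1 - ε)K` relative to the uniform law, with `K` the mean-zero
kernel; expanding the product over coordinates gives the sum over `S`. -/
theorem prod_noise_eq (ε : ℝ) (η : ι → G) :
    ∏ d, noise ε (η d) =
      (Fintype.card (ι → G) : ℝ)⁻¹ * ∑ S : Finset ι, (1 - ε) ^ S.card * kernel S η := by
  have hG : (Fintype.card G : ℝ) ≠ 0 := Nat.cast_ne_zero.mpr Fintype.card_ne_zero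
  have h (g : G) : noise ε g =
      (Fintype.card G : ℝ)⁻¹ * (1 + (1 - ε) * meanZeroKernel g) := by
    unfold noise meanZeroKernel
    field_simp
    ring
  simp only [sum_pow_card_mul_kernel, h, Finset.prod_mul_distrib]
  simp

/-- Coordinates are independent. One lying in exactly one of `S`, `T` leaves a single kernel, which
averages to zero; one lying in both reproduces the kernel. -/
theorem expect_kernel_mul_kernel (S T : Finset ι) (x z : ι → G) :
    𝔼 u : ι → G, kernel S (x * u) * kernel T (u⁻¹ * z) =
      if S = T then kernel S (x * z) else 0 := by
  have h : 𝔼 u : ι → G, kernel S (x * u) * kernel T (u⁻¹ * z) =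
      ∏ d, 𝔼 g : G, (if d ∈ S then meanZeroKernel (x d * g) else 1) *
        (if d ∈ T then meanZeroKernel (g⁻¹ * z d) else 1) := by
    rw [← expect_pi_prod fun d g => (if d ∈ S then meanZeroKernel (x d * g) else 1) *
        (if d ∈ T then meanZeroKernel (g⁻¹ * z d) else 1)]
    simp only [kernel_eq_prod_ite, Finset.prod_mul_distrib, Pi.mul_apply, Pi.inv_apply]
  rw [h]
  split_ifs with hST
  · subst hST
    rw [kernel_eq_prod_ite]
    refine Finset.prod_congr rfl fun d _ => ?_
    split_ifs
    · exact expect_meanZeroKernel_mul_meanZeroKernel _ _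
    · simp
  · obtain ⟨d, hd⟩ : ∃ d, ¬ (d ∈ S ↔ d ∈ T) := by
      by_contra! H
      exact hST (Finset.ext H)
    refine Finset.prod_eq_zero (Finset.mem_univ d) ?_
    by_cases hS : d ∈ S
    · have hT : d ∉ T := fun hT => hd (by simp [hS, hT])
      simp [hS, hT, expect_meanZeroKernel_mul_left]
    · have hT : d ∈ T := by by_contra hT; exact hd (by simp [hS, hT])
      simp [hS, hT, expect_meanZeroKernel_inv_mul]

/-- The Efron–Stein component of `f` indexed by `S`. -/
noncomputable def component (S : Finset ι) (f : (ι → G) → ℝ) (x : ι → G) : ℝ :=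
  𝔼 u, kernel S (x⁻¹ * u) * f u

theorem sum_component (f : (ι → G) → ℝ) (x : ι → G) :
    ∑ S : Finset ι, component S f x = f x := by
  classical
  have hG : (Fintype.card (ι → G) : ℝ) ≠ 0 := Nat.cast_ne_zero.mpr Fintype.card_ne_zero
  have h (u : ι → G) : ∑ S : Finset ι, kernel S (x⁻¹ * u) =
      if u = x then (Fintype.card (ι → G) : ℝ) else 0 := by
    have := sum_pow_card_mul_kernel 1 (x⁻¹ * u)
    simp only [one_pow, one_mul, meanZeroKernel, add_sub_cancel] at this
    rw [this]
    split_ifs with hu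
    · simp [hu]
    · obtain ⟨d, hd⟩ := Function.ne_iff.mp hu
      refine Finset.prod_eq_zero (Finset.mem_univ d) ?_
      simp [inv_mul_eq_one, Ne.symm hd]
  simp only [component]
  rw [← Finset.expect_sum_comm]
  simp only [← Finset.sum_mul, h, Fintype.expect_eq_sum_div_card]
  rw [Finset.sum_congr rfl fun u _ => ite_mul _ _ _ _]
  simp only [zero_mul, Finset.sum_ite_eq', Finset.mem_univ, if_true]
  exact mul_div_cancel_left₀ _ hG

theorem component_component (S T : Finset ι) (f : (ι → G) → ℝ) (x : ι → G) :
    component S (component T f) x = if S = T then component S f x else 0 := by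
  simp only [component, mul_expect]
  rw [expect_comm]
  simp only [← mul_assoc, ← expect_mul, expect_kernel_mul_kernel]
  split_ifs <;> simp

/-- The projection is self-adjoint because its kernel is invariant under inversion. -/
theorem expect_component_mul (S : Finset ι) (f g : (ι → G) → ℝ) :
    𝔼 x, component S f x * g x = 𝔼 x, f x * component S g x := by
  simp only [component, mul_expect, expect_mul]
  rw [expect_comm]
  refine expect_congr rfl fun x _ => expect_congr rfl fun u _ => ?_
  rw [← kernel_inv, mul_inv_rev, inv_inv]
  ring

theorem expect_component_mul_component (S T : Finset ι) (f : (ι → G) → ℝ) :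
    𝔼 x, component S f x * component T f x =
      if S = T then 𝔼 x, component S f x ^ 2 else 0 := by
  split_ifs with h
  · simp [h, sq]
  · rw [expect_component_mul]
    simp [component_component, h]

/-- The squared `L²` norm of the Efron–Stein component of `f` indexed by `S`. -/
noncomputable def energy (S : Finset ι) (f : (ι → G) → ℝ) : ℝ := 𝔼 x, component S f x ^ 2

theorem energy_nonneg (S : Finset ι) (f : (ι → G) → ℝ) : 0 ≤ energy S f :=
  Finset.expect_nonneg fun _ _ => sq_nonneg _

theorem sum_energy (f : (ι → G) → ℝ) : ∑ S, energy S f = 𝔼 x, f x ^ 2 := by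
  have h (S : Finset ι) : energy S f = 𝔼 x, f x * component S f x := by
    rw [← expect_component_mul, energy]
    have := expect_component_mul S f (component S f)
    simp only [component_component, if_true] at this
    simp only [sq, this, expect_component_mul]
  simp only [h]
  rw [← Finset.expect_sum_comm]
  simp only [← Finset.mul_sum, sum_component, sq]

theorem sum_energy_le_one {f : (ι → G) → ℝ} (hf : ∀ x, |f x| ≤ 1) : ∑ S, energy S f ≤ 1 := by
  rw [sum_energy]
  refine Finset.expect_le Finset.univ_nonempty fun x _ => ?_
  rw [sq_le_one_iff_abs_le_one]
  exact hf x

theorem expect_sq_sum_component (𝓑 : Finset (Finset ι)) (f : (ι → G) → ℝ) :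
    𝔼 x, (∑ B ∈ 𝓑, component B f x) ^ 2 = ∑ B ∈ 𝓑, energy B f := by
  simp only [sq (∑ B ∈ 𝓑, _), Finset.sum_mul_sum, Finset.expect_sum_comm]
  refine Finset.sum_congr rfl fun B hB => ?_
  rw [Finset.sum_congr rfl fun C _ => expect_component_mul_component B C f, Finset.sum_ite_eq,
    if_pos hB, energy]

/-- The part of the correlation of `f` and `g`, shifted by `z`, that comes from the Efron–Stein
components indexed by `S`. -/
noncomputable def correlation (S : Finset ι) (f g : (ι → G) → ℝ) (z : ι → G) : ℝ :=
  𝔼 x, 𝔼 u, f x * g u * kernel S (x * u * z)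

/-- Averaging over `u` turns `g` into its component at `(z * x)⁻¹`. As a function of `x` this is
again a pure `S`-component, so `f` may be replaced by its own; Cauchy–Schwarz then gives a bound
uniform in `z`. -/
theorem abs_correlation_le (S : Finset ι) (f g : (ι → G) → ℝ) (z : ι → G) :
    |correlation S f g z| ≤ √(energy S f) * √(energy S g) := by
  have h1 (x : ι → G) : 𝔼 u, f x * g u * kernel S (x * u * z) =
      f x * component S g (z * x)⁻¹ := by
    rw [component, mul_expect]
    refine expect_congr rfl fun u _ => ?_
    rw [inv_inv, kernel_mul_comm, ← mul_assoc]
    ring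
  have h2 (x : ι → G) : component S (fun x => component S g (z * x)⁻¹) x =
      component S g (z * x)⁻¹ := by
    have := component_component S S g (z * x)⁻¹
    rw [if_pos rfl] at this
    rw [← this]
    conv_lhs => rw [component]
    conv_rhs => rw [component]
    refine Fintype.expect_equiv ((Equiv.mulLeft z).trans (Equiv.inv _)) _ _ fun u => ?_
    simp only [Equiv.trans_apply, Equiv.coe_mulLeft, Equiv.inv_apply, inv_inv]
    rw [← kernel_inv S (x⁻¹ * u), kernel_mul_comm S (z * x), mul_inv_rev, inv_inv, mul_inv_rev]
    simp [mul_assoc]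
  have h3 : correlation S f g z = 𝔼 x, component S f x * component S g (z * x)⁻¹ := by
    rw [expect_component_mul]
    simp only [correlation, h1, h2]
  rw [h3]
  refine (abs_expect_mul_le_sqrt _ _).trans_eq ?_
  rw [energy, energy, expect_mul_left z (fun x => component S g x⁻¹ ^ 2),
    expect_inv fun x => component S g x ^ 2]

/-- The kernel sees only the coordinates in `S`, so translating by `s c` leaves the component
unchanged; averaging over `c` then kills it. -/
theorem component_eq_zero_of_shift {S : Finset ι} {f : (ι → G) → ℝ} {s : G → ι → G}
    (hs : ∀ c, ∀ d ∈ S, s c d = 1) (hf : ∀ x, 𝔼 c, f (s c * x) = 0) (x : ι → G) :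
    component S f x = 0 := by
  have h (c : G) : component S f x = 𝔼 u, kernel S (x⁻¹ * u) * f (s c * u) := by
    rw [component, ← expect_mul_left (s c)]
    refine expect_congr rfl fun u _ => ?_
    congr 1
    refine Finset.prod_congr rfl fun d hd => ?_
    simp [hs c d hd]
  rw [← Fintype.expect_const (ι := G) (component S f x), expect_congr rfl fun c _ => h c,
    expect_comm]
  simp only [← mul_expect, hf, mul_zero, Finset.expect_const_zero]

/-! ### Pulling back along a projection -/

variable {κ : Type*} [Fintype κ] [DecidableEq κ]

/-- The product factors over the fibres of `π`. In either case `y l` occurs in exactly one mean-zero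
kernel, so its average vanishes. -/
theorem expect_kernel_comp_mul_kernel_eq_zero {ι : Type*} (π : ι → κ) {S : Finset ι} {B : Finset κ} {l : κ}
    (hl : (l ∈ B ∧ l ∉ S.image π) ∨ (l ∉ B ∧ ∃ d₀ ∈ S, π d₀ = l ∧ ∀ d ∈ S, π d = l → d = d₀))
    (a : ι → G) (v : κ → G) :
    𝔼 y : κ → G, kernel S (a * y ∘ π) * kernel B (y⁻¹ * v) = 0 := by
  have h (y : κ → G) : kernel S (a * y ∘ π) * kernel B (y⁻¹ * v) =
      ∏ k, (∏ d ∈ S with π d = k, meanZeroKernel (a d * y k)) *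
        (if k ∈ B then meanZeroKernel ((y k)⁻¹ * v k) else 1) := by
    rw [Finset.prod_mul_distrib, kernel_eq_prod_ite B, kernel, ← Finset.prod_fiberwise S π]
    congr 1
    refine Finset.prod_congr rfl fun k _ => Finset.prod_congr rfl fun d hd => ?_
    simp [(Finset.mem_filter.mp hd).2]
  simp only [h]
  rw [expect_pi_prod fun k g => (∏ d ∈ S with π d = k, meanZeroKernel (a d * g)) *
        (if k ∈ B then meanZeroKernel (g⁻¹ * v k) else 1)]
  refine Finset.prod_eq_zero (Finset.mem_univ l) ?_
  rcases hl with ⟨hB, hS⟩ | ⟨hB, d₀, hd₀, hπ, huniq⟩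
  · have : ({d ∈ S | π d = l} : Finset ι) = ∅ := by
      refine Finset.filter_eq_empty_iff.mpr fun d hd hdl => hS ?_
      exact Finset.mem_image.mpr ⟨d, hd, hdl⟩
    simp [this, hB, expect_meanZeroKernel_inv_mul]
  · have : ({d ∈ S | π d = l} : Finset ι) = {d₀} := by
      ext d
      simp only [Finset.mem_filter, Finset.mem_singleton]
      exact ⟨fun hd => huniq d hd.1 hd.2, fun hd => hd ▸ ⟨hd₀, hπ⟩⟩
    simp [this, hB, expect_meanZeroKernel_mul_left]

theorem expect_mul_correlation_comp_eq_zero (π : ι → κ) {S : Finset ι} {B : Finset κ} {l : κ}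
    (hl : (l ∈ B ∧ l ∉ S.image π) ∨ (l ∉ B ∧ ∃ d₀ ∈ S, π d₀ = l ∧ ∀ d ∈ S, π d = l → d = d₀))
    (f g : (ι → G) → ℝ) (h : (κ → G) → ℝ) :
    𝔼 y : κ → G, component B h y * correlation S f g (y ∘ π) = 0 := by
  simp only [correlation, component, mul_expect, expect_mul]
  rw [expect_comm]
  refine Finset.expect_eq_zero fun x _ => ?_
  rw [expect_comm]
  refine Finset.expect_eq_zero fun u _ => ?_
  rw [expect_comm]
  refine Finset.expect_eq_zero fun v _ => ?_
  have := expect_kernel_comp_mul_kernel_eq_zero π hl (x * u) v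
  rw [← mul_zero (h v * (f x * g u)), ← this, mul_expect]
  exact expect_congr rfl fun y _ => by ring

theorem abs_expect_mul_correlation_comp_le (π : ι → κ) (S : Finset ι) (f g : (ι → G) → ℝ)
    (h : (κ → G) → ℝ) :
    |𝔼 y, h y * correlation S f g (y ∘ π)| ≤
      √(energy S f) * √(energy S g) * √(𝔼 y, h y ^ 2) := by
  refine (abs_expect_mul_le_sqrt _ _).trans ?_
  rw [mul_comm]
  refine mul_le_mul_of_nonneg_right ?_ (Real.sqrt_nonneg _)
  refine Real.sqrt_le_iff.mpr ⟨by positivity, Finset.expect_le Finset.univ_nonempty fun y _ => ?_⟩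
  rw [← sq_abs]
  exact pow_le_pow_left₀ (abs_nonneg _) (abs_correlation_le _ _ _ _) 2

/-! ### Low-degree influences -/

open Classical in
/-- The low-degree influence of the coordinate `l` on `h`. -/
noncomputable def lowDegreeInfluence (ζ : ℝ) (h : (κ → G) → ℝ) (l : κ) : ℝ :=
  ∑ B : Finset κ with l ∈ B ∧ (B.card : ℝ) ≤ ζ, energy B h

theorem lowDegreeInfluence_nonneg (ζ : ℝ) (h : (κ → G) → ℝ) (l : κ) :
    0 ≤ lowDegreeInfluence ζ h l :=
  Finset.sum_nonneg fun _ _ => energy_nonneg _ _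

/-- Each `B` of size at most `ζ` is counted `|B|` times, and the energies sum to at most one. -/
theorem sum_lowDegreeInfluence_le {ζ : ℝ} (hζ : 0 ≤ ζ) {h : (κ → G) → ℝ} (hh : ∀ y, |h y| ≤ 1) :
    ∑ l, lowDegreeInfluence ζ h l ≤ ζ := by
  classical
  simp only [lowDegreeInfluence, Finset.sum_filter]
  rw [Finset.sum_comm]
  refine (Finset.sum_le_sum (g := fun B => ζ * energy B h) fun B _ => ?_).trans ?_
  · by_cases hB : (B.card : ℝ) ≤ ζ
    · simp only [hB, and_true, Finset.sum_ite_mem, Finset.univ_inter, Finset.sum_const,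
        nsmul_eq_mul]
      exact mul_le_mul_of_nonneg_right hB (energy_nonneg _ _)
    · simp only [hB, and_false, if_false, Finset.sum_const_zero]
      exact mul_nonneg hζ (energy_nonneg _ _)
  · rw [← Finset.mul_sum]
    exact mul_le_of_le_one_right hζ (sum_energy_le_one hh)

/-- If `d₀` is the only element of `S` over `π d₀`, then only the components of `h` of degree at
most `|S|` that depend on the coordinate `π d₀` contribute. -/
theorem abs_expect_mul_correlation_comp_le_lowDegreeInfluence (π : ι → κ) {S : Finset ι} {d₀ : ι}
    (hd₀ : d₀ ∈ S) (huniq : ∀ d ∈ S, π d = π d₀ → d = d₀) {ζ : ℝ} (hS : (S.card : ℝ) ≤ ζ)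
    (f g : (ι → G) → ℝ) (h : (κ → G) → ℝ) :
    |𝔼 y, h y * correlation S f g (y ∘ π)| ≤
      √(energy S f) * √(energy S g) * √(lowDegreeInfluence ζ h (π d₀)) := by
  classical
  have key : 𝔼 y, h y * correlation S f g (y ∘ π) =
      𝔼 y, (∑ B : Finset κ with π d₀ ∈ B ∧ (B.card : ℝ) ≤ ζ, component B h y) *
        correlation S f g (y ∘ π) := by
    simp only [Finset.sum_mul, Finset.expect_sum_comm]
    rw [Finset.sum_filter_of_ne]
    · rw [← Finset.expect_sum_comm]
      simp only [← Finset.sum_mul, sum_component]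
    · intro B _ hB
      by_contra hcon
      refine hB ?_
      -- A discarded `B` is either too large to fit inside `π(S)`, so some coordinate of `B` is not
      -- covered by `S`, or it misses `π d₀`, which `S` covers exactly once.
      by_cases hmem : π d₀ ∈ B
      · have hcard : ¬ B ⊆ S.image π := fun hsub => hcon ⟨hmem, le_trans (by
          exact_mod_cast (Finset.card_le_card hsub).trans Finset.card_image_le) hS⟩
        obtain ⟨l, hlB, hlS⟩ := Finset.not_subset.mp hcard
        exact expect_mul_correlation_comp_eq_zero π (Or.inl ⟨hlB, hlS⟩) f g h
      · exact expect_mul_correlation_comp_eq_zero π (Or.inr ⟨hmem, d₀, hd₀, rfl, huniq⟩) f g h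
  rw [key]
  refine (abs_expect_mul_correlation_comp_le _ _ _ _ _).trans_eq ?_
  rw [expect_sq_sum_component, lowDegreeInfluence]

/-- The expectation of the test in terms of the Efron–Stein components. -/
theorem expect_noise_eq_sum_correlation (π : ι → κ) (ε : ℝ) (f g : (ι → G) → ℝ)
    (h : (κ → G) → ℝ) :
    𝔼 x : ι → G, 𝔼 y : κ → G, ∑ η : ι → G, (∏ d, noise ε (η d)) *
        (f x * g (fun d => (x d)⁻¹ * η d * (y (π d))⁻¹) * h y) =
      ∑ S : Finset ι, (1 - ε) ^ S.card * 𝔼 y, h y * correlation S f g (y ∘ π) := by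
  have h1 (x : ι → G) (y : κ → G) : ∑ η : ι → G, (∏ d, noise ε (η d)) *
        (f x * g (fun d => (x d)⁻¹ * η d * (y (π d))⁻¹) * h y) =
      ∑ S : Finset ι, (1 - ε) ^ S.card *
        (h y * 𝔼 u, f x * g u * kernel S (x * u * y ∘ π)) := by
    have h2 : ∑ η : ι → G, (∏ d, noise ε (η d)) *
        (f x * g (fun d => (x d)⁻¹ * η d * (y (π d))⁻¹) * h y) =
        𝔼 η : ι → G, ∑ S : Finset ι, (1 - ε) ^ S.card *
          (h y * (f x * g (x⁻¹ * η * (y ∘ π)⁻¹) * kernel S η)) := by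
      rw [Fintype.expect_eq_sum_div_card, Finset.sum_div]
      refine Finset.sum_congr rfl fun η _ => ?_
      rw [prod_noise_eq, Finset.mul_sum, Finset.sum_mul, Finset.sum_div]
      refine Finset.sum_congr rfl fun S _ => ?_
      have : (fun d => (x d)⁻¹ * η d * (y (π d))⁻¹) = x⁻¹ * η * (y ∘ π)⁻¹ := rfl
      rw [this]
      ring
    rw [h2, Finset.expect_sum_comm]
    refine Finset.sum_congr rfl fun S _ => ?_
    rw [← mul_expect, ← mul_expect]
    congr 2
    -- Substitute `u = x⁻¹ η (y ∘ π)⁻¹`, that is `η = x u (y ∘ π)`.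
    refine Fintype.expect_equiv ((Equiv.mulLeft x⁻¹).trans (Equiv.mulRight (y ∘ π)⁻¹)) _ _
      fun η => ?_
    simp [mul_assoc]
  simp only [h1, Finset.expect_sum_comm, ← mul_expect, correlation]
  refine Finset.sum_congr rfl fun S _ => ?_
  rw [expect_comm]
  simp only [← mul_expect]

end EfronStein

/-! ### Randomised strategies for a Label Cover -/

/-- Derandomisation: `σ a` maximises the total payoff of the edges over `a`. As payoffs are
nonnegative, subprobability weights suffice. -/
theorem exists_sum_le_sum_choice {A B E : Type*} [Fintype A] [Fintype B] [Nonempty B] [Fintype E]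
    (k : E → A) {p : A → B → ℝ} (hp : ∀ a b, 0 ≤ p a b) (hp1 : ∀ a, ∑ b, p a b ≤ 1)
    {F : E → B → ℝ} (hF : ∀ e b, 0 ≤ F e b) :
    ∃ σ : A → B, ∑ e, ∑ b, p (k e) b * F e b ≤ ∑ e, F e (σ (k e)) := by
  classical
  have h (a : A) : ∃ b, ∀ b', ∑ e with k e = a, F e b' ≤ ∑ e with k e = a, F e b :=
    Finite.exists_max fun b => ∑ e with k e = a, F e b
  choose σ hσ using h
  refine ⟨σ, ?_⟩
  rw [← Finset.sum_fiberwise Finset.univ k, ← Finset.sum_fiberwise Finset.univ k]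
  refine Finset.sum_le_sum fun a _ => ?_
  have h1 : ∑ e with k e = a, ∑ b, p (k e) b * F e b =
      ∑ b, p a b * ∑ e with k e = a, F e b := by
    rw [Finset.sum_comm]
    refine Finset.sum_congr rfl fun b _ => ?_
    rw [Finset.mul_sum]
    exact Finset.sum_congr rfl fun e he => by rw [(Finset.mem_filter.mp he).2]
  have h2 : ∑ e with k e = a, F e (σ (k e)) = ∑ e with k e = a, F e (σ a) :=
    Finset.sum_congr rfl fun e he => by rw [(Finset.mem_filter.mp he).2]
  rw [h1, h2]
  calc ∑ b, p a b * ∑ e with k e = a, F e b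
      ≤ ∑ b, p a b * ∑ e with k e = a, F e (σ a) :=
        Finset.sum_le_sum fun b _ => mul_le_mul_of_nonneg_left (hσ a b) (hp a b)
    _ = (∑ b, p a b) * ∑ e with k e = a, F e (σ a) := by rw [Finset.sum_mul]
    _ ≤ _ := mul_le_of_le_one_left (Finset.sum_nonneg fun _ _ => hF _ _) (hp1 a)

theorem sum_sqrt_energy_mul_le_one {R : Type*} [Fintype R] [DecidableEq R]
    {G : Type*} [Group G] [Fintype G] {f g : (R → G) → ℝ} (hf : ∀ x, |f x| ≤ 1)
    (hg : ∀ x, |g x| ≤ 1) : ∑ S, √(energy S f) * √(energy S g) ≤ 1 := by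
  have h (S : Finset R) : √(energy S f) * √(energy S g) ≤ (energy S f + energy S g) / 2 := by
    nlinarith [sq_nonneg (√(energy S f) - √(energy S g)), Real.sq_sqrt (energy_nonneg S f),
      Real.sq_sqrt (energy_nonneg S g)]
  refine (Finset.sum_le_sum fun S _ => h S).trans ?_
  rw [← Finset.sum_div, Finset.sum_add_distrib]
  linarith [sum_energy_le_one hf, sum_energy_le_one hg]

namespace UFGLabelCover

variable {V W E L R : Type*} {r m : ℕ}

/-- The side conditions of the vertex `w` hold for the label `d`. -/
def Good (Λ : UFGLabelCover V W E L R r m) (w : W) (d : R) : Prop :=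
  ∀ i, Λ.p i d = Λ.b (Λ.idx w i)

variable [Fintype E]

theorem value_le_one (Λ : UFGLabelCover V W E L R r m) (σL : V → L) (σR : W → R) :
    Λ.value σL σR ≤ 1 := by
  refine div_le_one_of_le₀ ?_ (Nat.cast_nonneg _)
  exact_mod_cast Finset.card_le_univ _

theorem value_le_opt (Λ : UFGLabelCover V W E L R r m) (σL : V → L) (σR : W → R) :
    Λ.value σL σR ≤ Λ.opt :=
  le_ciSup (f := fun σ : (V → L) × (W → R) => Λ.value σ.1 σ.2)
    ⟨1, by rintro _ ⟨σ, rfl⟩; exact Λ.value_le_one _ _⟩ (σL, σR)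

-- The first prover is derandomised against the random second one, and then the second against the
-- fixed first.
open Classical in
theorem expect_randomised_le_opt [Fintype V] [Fintype W] [Fintype L] [Fintype R] [Nonempty L]
    [Nonempty R] (Λ : UFGLabelCover V W E L R r m) {p : W → R → ℝ} {q : V → L → ℝ}
    (hp : ∀ w d, 0 ≤ p w d) (hp1 : ∀ w, ∑ d, p w d ≤ 1)
    (hq : ∀ v l, 0 ≤ q v l) (hq1 : ∀ v, ∑ l, q v l ≤ 1) :
    𝔼 e, ∑ d, p (Λ.right e) d *
      (if Λ.Good (Λ.right e) d then q (Λ.left e) (Λ.proj e d) else 0) ≤ Λ.opt := by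
  obtain ⟨σR, hR⟩ := exists_sum_le_sum_choice Λ.right hp hp1
    (F := fun e d => if Λ.Good (Λ.right e) d then q (Λ.left e) (Λ.proj e d) else 0)
    fun e d => by split_ifs; exacts [hq _ _, le_rfl]
  obtain ⟨σL, hL⟩ := exists_sum_le_sum_choice Λ.left hq hq1
    (F := fun e l => if Λ.proj e (σR (Λ.right e)) = l ∧ Λ.Good (Λ.right e) (σR (Λ.right e))
      then 1 else 0)
    fun e d => by split_ifs; exacts [zero_le_one, le_rfl]
  refine le_trans ?_ (Λ.value_le_opt σL σR)
  rw [Fintype.expect_eq_sum_div_card, value]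
  refine div_le_div_of_nonneg_right ?_ (Nat.cast_nonneg _)
  refine hR.trans (le_trans (le_of_eq ?_) (hL.trans (le_of_eq ?_)))
  · refine Finset.sum_congr rfl fun e _ => ?_
    by_cases h : Λ.Good (Λ.right e) (σR (Λ.right e)) <;> simp [h]
  · rw [Finset.sum_boole]
    congr

/-! ### Smoothness and collisions -/

/-- `τ`-smoothness: given the right vertex of a random edge, any two distinct labels are identified
by the projection with probability at most `τ`. -/
def Smooth [DecidableEq L] [DecidableEq R] (Λ : UFGLabelCover V W E L R r m) (τ : ℝ) : Prop :=
  ∀ φ : W → ℝ, (∀ w, 0 ≤ φ w) → ∀ d d' : W → R,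
    𝔼 e, φ (Λ.right e) * (if d (Λ.right e) ≠ d' (Λ.right e) ∧
      Λ.proj e (d (Λ.right e)) = Λ.proj e (d' (Λ.right e)) then 1 else 0) ≤
    τ * 𝔼 e, φ (Λ.right e)

/-- A union bound over the at most `ζ` labels of `S`; smoothness applies with `c · S` as the weight
because it depends on `w` alone. -/
theorem expect_sum_collision_le [Fintype R] [DecidableEq L] [DecidableEq R]
    (Λ : UFGLabelCover V W E L R r m) {τ ζ : ℝ} (hΛ : Λ.Smooth τ)
    (hτ : 0 ≤ τ) (hζ : 0 ≤ ζ) {c : W → Finset R → ℝ} (hc : ∀ w S, 0 ≤ c w S)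
    (hc1 : ∀ w, ∑ S, c w S ≤ 1) (d₀ : W → Finset R → R) :
    𝔼 e, ∑ S with (S.card : ℝ) ≤ ζ, ∑ d ∈ S, c (Λ.right e) S *
      (if d ≠ d₀ (Λ.right e) S ∧ Λ.proj e d = Λ.proj e (d₀ (Λ.right e) S) then 1 else 0) ≤
      ζ * τ := by
  have hE := Λ.edge_nonempty
  simp only [Finset.expect_sum_comm]
  calc
    _ ≤ ∑ S : Finset R with (S.card : ℝ) ≤ ζ, ∑ d ∈ S, τ * 𝔼 e, c (Λ.right e) S :=
        Finset.sum_le_sum fun S _ => Finset.sum_le_sum fun d _ =>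
          hΛ (fun w => c w S) (fun w => hc w S) (fun _ => d) (fun w => d₀ w S)
    _ ≤ ∑ S : Finset R with (S.card : ℝ) ≤ ζ, ζ * (τ * 𝔼 e, c (Λ.right e) S) := by
        refine Finset.sum_le_sum fun S hS => ?_
        rw [Finset.sum_const, nsmul_eq_mul]
        exact mul_le_mul_of_nonneg_right (Finset.mem_filter.mp hS).2
          (mul_nonneg hτ (Finset.expect_nonneg fun _ _ => hc _ _))
    _ ≤ ∑ S : Finset R, ζ * (τ * 𝔼 e, c (Λ.right e) S) :=
        Finset.sum_le_sum_of_subset_of_nonneg (Finset.filter_subset _ _) fun S _ _ =>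
          mul_nonneg hζ (mul_nonneg hτ (Finset.expect_nonneg fun _ _ => hc _ _))
    _ = ζ * τ * 𝔼 e, ∑ S, c (Λ.right e) S := by
        rw [Finset.expect_sum_comm, Finset.mul_sum]
        simp only [mul_assoc]
    _ ≤ ζ * τ := by
        refine mul_le_of_le_one_right (mul_nonneg hζ hτ) ?_
        exact Finset.expect_le Finset.univ_nonempty fun e _ => hc1 _

/-! ### Soundness for real-valued tables -/

section Soundness

variable [Fintype V] [Fintype W] [Fintype L] [DecidableEq L] [Nonempty L] [Fintype R]
  [DecidableEq R] [Nonempty R] {G : Type*} [Group G] [Fintype G]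

open Classical in
/-- Decoding: the provers choose labels according to the energies and the low-degree influences
of their tables. -/
theorem expect_sum_energy_mul_lowDegreeInfluence_le (Λ : UFGLabelCover V W E L R r m)
    {f : W → (R → G) → ℝ} {h : V → (L → G) → ℝ} (hf : ∀ w x, |f w x| ≤ 1)
    (hh : ∀ v y, |h v y| ≤ 1) {ζ : ℝ} (hζ : 0 < ζ) (d₀ : W → Finset R → R) :
    𝔼 e, ∑ S, energy S (f (Λ.right e)) *
      (if Λ.Good (Λ.right e) (d₀ (Λ.right e) S) then
        lowDegreeInfluence ζ (h (Λ.left e)) (Λ.proj e (d₀ (Λ.right e) S)) else 0) ≤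
      ζ * Λ.opt := by
  have key := Λ.expect_randomised_le_opt
    -- The first prover draws `S` with weight its energy and answers `d₀ w S`; the total influence
    -- is at most `ζ`, hence the normalisation of `q`.
    (p := fun w d => ∑ S with d₀ w S = d, energy S (f w))
    (q := fun v l => lowDegreeInfluence ζ (h v) l / ζ)
    (fun w d => Finset.sum_nonneg fun _ _ => energy_nonneg _ _)
    (fun w => by rw [Finset.sum_fiberwise]; exact sum_energy_le_one (hf w))
    (fun v l => div_nonneg (lowDegreeInfluence_nonneg _ _ _) hζ.le)
    (fun v => by
      rw [← Finset.sum_div]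
      exact div_le_one_of_le₀ (sum_lowDegreeInfluence_le hζ.le (hh v)) hζ.le)
  refine le_trans (le_of_eq ?_) (mul_le_mul_of_nonneg_left key hζ.le)
  rw [mul_expect]
  refine expect_congr rfl fun e _ => ?_
  rw [Finset.mul_sum, ← Finset.sum_fiberwise Finset.univ (d₀ (Λ.right e))]
  refine Finset.sum_congr rfl fun d _ => ?_
  rw [Finset.sum_mul, Finset.mul_sum]
  refine Finset.sum_congr rfl fun S hS => ?_
  rw [(Finset.mem_filter.mp hS).2]
  split_ifs
  · field_simp
  · simp

/-- The soundness bound for one triple of bounded real-valued tables, the first of which only has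
Efron–Stein components that depend on a label satisfying the side conditions. -/
theorem expect_sum_correlation_le (Λ : UFGLabelCover V W E L R r m)
    {f g : W → (R → G) → ℝ} {h : V → (L → G) → ℝ}
    (hf : ∀ w x, |f w x| ≤ 1) (hg : ∀ w x, |g w x| ≤ 1) (hh : ∀ v y, |h v y| ≤ 1)
    (hfold : ∀ w S, (∀ d ∈ S, ¬ Λ.Good w d) → energy S (f w) = 0)
    {ε τ ζ ρ : ℝ} (hε₀ : 0 ≤ ε) (hε₁ : ε ≤ 1) (hτ : 0 ≤ τ) (hΛ : Λ.Smooth τ) (hζ : 0 < ζ)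
    (hρ₀ : 0 ≤ ρ) (hρ : ∀ k : ℕ, ζ < k → (1 - ε) ^ k ≤ ρ) :
    𝔼 e, ∑ S : Finset R, (1 - ε) ^ S.card * 𝔼 y, h (Λ.left e) y *
        correlation S (f (Λ.right e)) (g (Λ.right e)) (y ∘ Λ.proj e) ≤
      ρ + ζ * τ + √(ζ * Λ.opt) := by
  classical
  have hE := Λ.edge_nonempty
  -- The choice depends on `w` and `S` only, not on the edge, since it becomes the answer of the
  -- first prover. Without a good label in `S` its value is arbitrary.
  have hd₀ (w : W) (S : Finset R) : ∃ d, (∃ d ∈ S, Λ.Good w d) → d ∈ S ∧ Λ.Good w d := by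
    by_cases H : ∃ d ∈ S, Λ.Good w d
    · obtain ⟨d, hd⟩ := H
      exact ⟨d, fun _ => hd⟩
    · exact ⟨Classical.arbitrary R, fun H' => absurd H' H⟩
  choose d₀ hd₀ using hd₀
  let α (w : W) (S : Finset R) : ℝ := √(energy S (f w))
  let β (w : W) (S : Finset R) : ℝ := √(energy S (g w))
  let U (e : E) (S : Finset R) : ℝ := √(if Λ.Good (Λ.right e) (d₀ (Λ.right e) S) then
    lowDegreeInfluence ζ (h (Λ.left e)) (Λ.proj e (d₀ (Λ.right e) S)) else 0)
  let X (e : E) (S : Finset R) (d : R) : ℝ :=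
    if d ≠ d₀ (Λ.right e) S ∧ Λ.proj e d = Λ.proj e (d₀ (Λ.right e) S) then 1 else 0
  have hα (w S) : 0 ≤ α w S := Real.sqrt_nonneg _
  have hβ (w S) : 0 ≤ β w S := Real.sqrt_nonneg _
  have hU (e S) : 0 ≤ U e S := Real.sqrt_nonneg _
  have hX (e S d) : 0 ≤ X e S d := by simp only [X]; split_ifs <;> norm_num
  have hαβ (w : W) : ∑ S, α w S * β w S ≤ 1 := sum_sqrt_energy_mul_le_one (hf w) (hg w)
  have hpow₀ (k : ℕ) : 0 ≤ (1 - ε) ^ k := pow_nonneg (by linarith) _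
  have hpow₁ (k : ℕ) : (1 - ε) ^ k ≤ 1 := pow_le_one₀ (by linarith) (by linarith)
  -- The three terms pay for large `S`, for small `S` with a collision at `d₀`, and for small `S`
  -- where `d₀` is alone in its fibre.
  have pointwise (e : E) (S : Finset R) : (1 - ε) ^ S.card * 𝔼 y, h (Λ.left e) y *
        correlation S (f (Λ.right e)) (g (Λ.right e)) (y ∘ Λ.proj e) ≤
      ρ * (α (Λ.right e) S * β (Λ.right e) S) +
        (if (S.card : ℝ) ≤ ζ then ∑ d ∈ S, α (Λ.right e) S * β (Λ.right e) S * X e S d else 0) +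
        α (Λ.right e) S * U e S * β (Λ.right e) S := by
    set w := Λ.right e
    set v := Λ.left e
    set C := 𝔼 y, h v y * correlation S (f w) (g w) (y ∘ Λ.proj e)
    have hAB : 0 ≤ α w S * β w S := mul_nonneg (hα _ _) (hβ _ _)
    have h1 : 0 ≤ ρ * (α w S * β w S) := mul_nonneg hρ₀ hAB
    have h2 : 0 ≤ if (S.card : ℝ) ≤ ζ then ∑ d ∈ S, α w S * β w S * X e S d else 0 := by
      split_ifs
      · exact Finset.sum_nonneg fun d _ => mul_nonneg hAB (hX _ _ _)
      · exact le_rfl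
    have h3 : 0 ≤ α w S * U e S * β w S := mul_nonneg (mul_nonneg (hα _ _) (hU _ _)) (hβ _ _)
    have hC : |C| ≤ α w S * β w S := by
      refine (abs_expect_mul_correlation_comp_le _ _ _ _ _).trans ?_
      refine mul_le_of_le_one_right hAB (Real.sqrt_le_one.mpr ?_)
      refine Finset.expect_le Finset.univ_nonempty fun y _ => ?_
      rw [sq_le_one_iff_abs_le_one]
      exact hh v y
    have hC' : (1 - ε) ^ S.card * C ≤ |C| :=
      (mul_le_mul_of_nonneg_left (le_abs_self C) (hpow₀ _)).trans
        (mul_le_of_le_one_left (abs_nonneg _) (hpow₁ _))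
    by_cases hgood : ∃ d ∈ S, Λ.Good w d
    · obtain ⟨hmem, hG⟩ := hd₀ w S hgood
      by_cases hcard : (S.card : ℝ) ≤ ζ
      · by_cases hcol : ∃ d ∈ S, d ≠ d₀ w S ∧ Λ.proj e d = Λ.proj e (d₀ w S)
        · obtain ⟨d, hdS, hd⟩ := hcol
          have : α w S * β w S ≤ ∑ d ∈ S, α w S * β w S * X e S d := by
            refine le_trans (le_of_eq ?_) (Finset.single_le_sum
              (fun d _ => mul_nonneg hAB (hX e S d)) hdS)
            rw [show X e S d = 1 from if_pos hd, mul_one]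
          rw [if_pos hcard]
          linarith
        · push Not at hcol
          have := abs_expect_mul_correlation_comp_le_lowDegreeInfluence (Λ.proj e) hmem
            (fun d hd hπ => by_contra fun hne => hcol d hd hne hπ) hcard (f w) (g w) (h v)
          have hUe : U e S = √(lowDegreeInfluence ζ (h v) (Λ.proj e (d₀ w S))) := by
            simp only [U]
            rw [if_pos hG]
          have : |C| ≤ α w S * U e S * β w S := by
            rw [hUe, mul_right_comm]
            exact this
          linarith
      · have : (1 - ε) ^ S.card * C ≤ ρ * (α w S * β w S) :=
          (mul_le_mul_of_nonneg_left ((le_abs_self C).trans hC) (hpow₀ _)).trans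
            (mul_le_mul_of_nonneg_right (hρ _ (not_le.mp hcard)) hAB)
        linarith
    · push Not at hgood
      have : α w S = 0 := by simp only [α, hfold w S hgood, Real.sqrt_zero]
      rw [this, zero_mul] at hC
      linarith
  have hB := expect_sum_collision_le Λ hΛ hτ hζ.le (c := fun w S => α w S * β w S)
    (fun w S => mul_nonneg (hα _ _) (hβ _ _)) hαβ d₀
  have hQ := expect_sum_energy_mul_lowDegreeInfluence_le Λ hf hh hζ d₀
  have hA : 𝔼 e, ∑ S, ρ * (α (Λ.right e) S * β (Λ.right e) S) ≤ ρ := by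
    refine Finset.expect_le Finset.univ_nonempty fun e _ => ?_
    rw [← Finset.mul_sum]
    exact mul_le_of_le_one_right hρ₀ (hαβ _)
  have hUsq (e : E) (S : Finset R) : (α (Λ.right e) S * U e S) ^ 2 =
      energy S (f (Λ.right e)) * (if Λ.Good (Λ.right e) (d₀ (Λ.right e) S) then
        lowDegreeInfluence ζ (h (Λ.left e)) (Λ.proj e (d₀ (Λ.right e) S)) else 0) := by
    rw [mul_pow, Real.sq_sqrt (energy_nonneg _ _), Real.sq_sqrt]
    split_ifs
    exacts [lowDegreeInfluence_nonneg _ _ _, le_rfl]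
  -- Cauchy–Schwarz twice: over `S`, where the squares of `β` sum to at most one, and then over the
  -- edges.
  have hC : 𝔼 e, ∑ S, α (Λ.right e) S * U e S * β (Λ.right e) S ≤ √(ζ * Λ.opt) := by
    have h1 (e : E) : ∑ S, α (Λ.right e) S * U e S * β (Λ.right e) S ≤
        √(∑ S, (α (Λ.right e) S * U e S) ^ 2) * 1 := by
      rw [mul_one]
      refine Real.le_sqrt_of_sq_le ((Finset.sum_mul_sq_le_sq_mul_sq _ _ _).trans ?_)
      refine mul_le_of_le_one_right (Finset.sum_nonneg fun _ _ => sq_nonneg _) ?_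
      simp only [β, Real.sq_sqrt (energy_nonneg _ _)]
      exact sum_energy_le_one (hg _)
    refine (Finset.expect_le_expect fun e _ => h1 e).trans ((le_abs_self _).trans
      ((abs_expect_mul_le_sqrt _ _).trans ?_))
    simp only [one_pow, Fintype.expect_const, Real.sqrt_one, mul_one]
    refine Real.sqrt_le_sqrt (le_trans (le_of_eq ?_) hQ)
    refine expect_congr rfl fun e _ => ?_
    rw [Real.sq_sqrt (Finset.sum_nonneg fun _ _ => sq_nonneg _)]
    exact Finset.sum_congr rfl fun S _ => hUsq e S
  refine (Finset.expect_le_expect fun e _ => Finset.sum_le_sum fun S _ => pointwise e S).trans ?_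
  simp only [Finset.sum_add_distrib, expect_add_distrib, ← Finset.sum_filter]
  exact add_le_add (add_le_add hA hB) hC

end Soundness

end UFGLabelCover

/-! ### Centred indicators -/

section Indicator

variable {G : Type*}

open Classical in
/-- The indicator of `g = a`. -/
noncomputable def indicator (a g : G) : ℝ := if g = a then 1 else 0

theorem abs_indicator_le_one (a g : G) : |indicator a g| ≤ 1 := by
  unfold indicator
  split_ifs <;> simp

variable [Fintype G]

theorem sum_indicator (g : G) : ∑ a, indicator a g = 1 := by
  classical
  simp [indicator]

variable [Group G]

/-- The indicator of `g = a` minus its average. -/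
noncomputable def centredIndicator (a g : G) : ℝ := indicator a g - (Fintype.card G : ℝ)⁻¹

theorem abs_centredIndicator_le_one (a g : G) : |centredIndicator a g| ≤ 1 := by
  have h0 : (0 : ℝ) ≤ (Fintype.card G : ℝ)⁻¹ := by positivity
  have h1 : (Fintype.card G : ℝ)⁻¹ ≤ 1 :=
    inv_le_one_of_one_le₀ (by exact_mod_cast Nat.one_le_iff_ne_zero.mpr Fintype.card_ne_zero)
  unfold centredIndicator indicator
  rw [abs_le]
  split_ifs <;> constructor <;> linarith

theorem expect_centredIndicator_mul_right (a g : G) : 𝔼 c, centredIndicator a (c * g) = 0 := by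
  classical
  rw [expect_mul_right g (centredIndicator a)]
  simp only [centredIndicator, indicator, Finset.expect_sub_distrib, Fintype.expect_const]
  simp [NNRat.smul_def]

theorem sum_centredIndicator (g : G) : ∑ a, centredIndicator a g = 0 := by
  simp [centredIndicator, sum_indicator]

/-- Summing over `b` forces `b = g`. Centring at `f` costs nothing, since the centred indicators of
`h` sum to zero over `a`; centring at `h` produces the main term. -/
theorem indicator_mul_mul_eq_one (f g h : G) :
    indicator 1 (f * g * h) = (Fintype.card G : ℝ)⁻¹ + ∑ a, ∑ b,
      centredIndicator a f * indicator b g * centredIndicator (a * b)⁻¹ h := by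
  classical
  have h1 (a : G) : ∑ b, centredIndicator a f * indicator b g * centredIndicator (a * b)⁻¹ h =
      centredIndicator a f * centredIndicator (a * g)⁻¹ h := by
    simp [indicator]
  have h2 : ∑ a : G, centredIndicator (a * g)⁻¹ h = 0 := by
    rw [← sum_centredIndicator h]
    exact Fintype.sum_equiv ((Equiv.mulRight g).trans (Equiv.inv G)) _ _ fun _ => rfl
  have h3 (a : G) : centredIndicator a f * centredIndicator (a * g)⁻¹ h =
      indicator a f * centredIndicator (a * g)⁻¹ h -
        (Fintype.card G : ℝ)⁻¹ * centredIndicator (a * g)⁻¹ h := by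
    rw [← sub_mul, centredIndicator]
  simp only [h1, h3, Finset.sum_sub_distrib, ← Finset.mul_sum, h2]
  simp [indicator, centredIndicator, mul_eq_one_iff_inv_eq, eq_comm]

end Indicator

/-! ### Folded tables -/

namespace UFGLabelCover

variable {V W E L R : Type*} {r m : ℕ} {G : Type*} [Group G]

/-- The factor is a choice, but it is determined at every tuple attained by some label. -/
theorem functionalFactor_apply (p : Fin r → R → ZMod 2) (x : R → G) (d : R) :
    functionalFactor p x (fun i => p i d) =
      x d * ((Quotient.mk (functionalSetoid G p) x).out d)⁻¹ :=
  eq_mul_inv_of_mul_eq (Classical.choose_spec (functional_out p x) d).symm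

/-- The functionally folded table of `w`. -/
noncomputable def functionalTable (Λ : UFGLabelCover V W E L R r m)
    (A : Query V W L R G Λ.p → G) (w : W) (x : R → G) : G :=
  functionalFactor Λ.p x (fun i => Λ.b (Λ.idx w i)) *
    A (Query.functional w (Quotient.mk _ x))

/-- The classically folded table of `v`. -/
noncomputable def classicalTable (Λ : UFGLabelCover V W E L R r m)
    (A : Query V W L R G Λ.p → G) (v : V) (y : L → G) : G :=
  A (Query.classical v (Quotient.mk _ y)) * classicalFactor y

/-- A good label attains the tuple of prescribed values, so the chosen factor is unambiguous there
and the folded table is equivariant. -/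
theorem functionalTable_mul (Λ : UFGLabelCover V W E L R r m)
    (hΛ : ∀ w, ∃ d, Λ.Good w d) (A : Query V W L R G Λ.p → G) (w : W)
    (F : (Fin r → ZMod 2) → G) (x : R → G) :
    Λ.functionalTable A w (fun d => F (fun i => Λ.p i d) * x d) =
      F (fun i => Λ.b (Λ.idx w i)) * Λ.functionalTable A w x := by
  obtain ⟨d, hd⟩ := hΛ w
  have hq : Quotient.mk (functionalSetoid G Λ.p) (fun d => F (fun i => Λ.p i d) * x d) =
      Quotient.mk (functionalSetoid G Λ.p) x := Quotient.sound ⟨F, fun _ => rfl⟩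
  have hb : (fun i => Λ.b (Λ.idx w i)) = fun i => Λ.p i d := funext fun i => (hd i).symm
  simp only [functionalTable, hb, functionalFactor_apply, hq, mul_assoc]

variable [Fintype G]

theorem energy_centredIndicator_functionalTable [Fintype R] [DecidableEq R]
    (Λ : UFGLabelCover V W E L R r m)
    (hΛ : ∀ w, ∃ d, Λ.Good w d) (A : Query V W L R G Λ.p → G) (w : W) (a : G) (S : Finset R)
    (hS : ∀ d ∈ S, ¬ Λ.Good w d) :
    energy S (fun x => centredIndicator a (Λ.functionalTable A w x)) = 0 := by
  classical
  refine Finset.expect_eq_zero fun x _ => ?_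
  rw [component_eq_zero_of_shift (s := fun c d => if Λ.Good w d then c else 1)
    (fun c d hd => if_neg (hS d hd)), zero_pow two_ne_zero]
  intro x
  rw [← expect_centredIndicator_mul_right a (Λ.functionalTable A w x)]
  refine expect_congr rfl fun c _ => ?_
  -- Taking `F` equal to `c` at the prescribed tuple and `1` elsewhere moves only the good
  -- coordinates, none of which lie in `S`, yet multiplies the table by `c`.
  have h := Λ.functionalTable_mul hΛ A w
    (fun u => if u = fun i => Λ.b (Λ.idx w i) then c else 1) x
  rw [if_pos rfl] at h
  rw [← h]
  congr 2
  funext d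
  simp only [Pi.mul_apply, funext_iff, Good]
  congr

/-! ### The value of the test -/

variable [Fintype E] [Fintype L] [DecidableEq L] [Fintype R] [DecidableEq R]

theorem test_value_eq (Λ : UFGLabelCover V W E L R r m) {ε : ℝ} (h0 : 0 ≤ ε) (h1 : ε ≤ 1)
    (A : Query V W L R G Λ.p → G) :
    (Λ.test G ε h0 h1).value A =
      𝔼 e, 𝔼 x : R → G, 𝔼 y : L → G, ∑ η : R → G, (∏ d, noise ε (η d)) *
        indicator 1 (Λ.functionalTable A (Λ.right e) x *
          A (Query.unfolded (Λ.right e) (fun d => (x d)⁻¹ * η d * (y (Λ.proj e d))⁻¹)) *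
          Λ.classicalTable A (Λ.left e) y) := by
  classical
  have key (F a b c C : G) : a * b * c = F⁻¹ * C⁻¹ ↔ F * a * b * (c * C) = 1 := by
    rw [eq_mul_inv_iff_mul_eq, eq_inv_iff_mul_eq_one, mul_eq_one_iff_eq_inv, eq_comm,
      ← mul_eq_one_iff_inv_eq]
    simp only [mul_assoc]
  simp only [MaxThreeLin.value, test, Fintype.sum_prod_type, Matrix.cons_val_zero,
    Matrix.cons_val_one, Matrix.cons_val, key, Fintype.expect_eq_sum_div_card, Finset.sum_div,
    functionalTable, classicalTable]
  refine Finset.sum_congr rfl fun e _ => Finset.sum_congr rfl fun x _ =>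
    Finset.sum_congr rfl fun y _ => Finset.sum_congr rfl fun η _ => ?_
  split_ifs with h
  · rw [indicator, if_pos h]
    field_simp
  · rw [indicator, if_neg h]
    simp

theorem sum_prod_noise (ε : ℝ) : ∑ η : R → G, ∏ d, noise ε (η d) = 1 := by
  rw [← Fintype.prod_sum fun (_ : R) (g : G) => noise ε g]
  simp [noise_sum]

theorem test_value_le_one (Λ : UFGLabelCover V W E L R r m) {ε : ℝ} (h0 : 0 ≤ ε) (h1 : ε ≤ 1)
    (A : Query V W L R G Λ.p → G) : (Λ.test G ε h0 h1).value A ≤ 1 := by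
  rw [← (Λ.test G ε h0 h1).weight_sum, MaxThreeLin.value]
  refine Finset.sum_le_sum fun c _ => ?_
  split_ifs
  exacts [le_rfl, (Λ.test G ε h0 h1).weight_nonneg c]

theorem test_value_le_opt (Λ : UFGLabelCover V W E L R r m) {ε : ℝ} (h0 : 0 ≤ ε) (h1 : ε ≤ 1)
    (A : Query V W L R G Λ.p → G) : (Λ.test G ε h0 h1).value A ≤ (Λ.test G ε h0 h1).opt :=
  le_ciSup (f := fun A => (Λ.test G ε h0 h1).value A)
    ⟨1, by rintro _ ⟨A, rfl⟩; exact Λ.test_value_le_one h0 h1 A⟩ A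

theorem expect_test_indicator_eq {E : Type*} (Λ : UFGLabelCover V W E L R r m) (ε : ℝ)
    (A : Query V W L R G Λ.p → G) (e : E) :
    𝔼 x : R → G, 𝔼 y : L → G, ∑ η : R → G, (∏ d, noise ε (η d)) *
        indicator 1 (Λ.functionalTable A (Λ.right e) x *
          A (Query.unfolded (Λ.right e) (fun d => (x d)⁻¹ * η d * (y (Λ.proj e d))⁻¹)) *
          Λ.classicalTable A (Λ.left e) y) =
      (Fintype.card G : ℝ)⁻¹ + ∑ a, ∑ b, ∑ S : Finset R, (1 - ε) ^ S.card *
        𝔼 y, centredIndicator (a * b)⁻¹ (Λ.classicalTable A (Λ.left e) y) *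
          correlation S (fun x => centredIndicator a (Λ.functionalTable A (Λ.right e) x))
            (fun z => indicator b (A (Query.unfolded (Λ.right e) z))) (y ∘ Λ.proj e) := by
  simp only [← expect_noise_eq_sum_correlation, ← Finset.expect_sum_comm]
  have hc : (Fintype.card G : ℝ)⁻¹ = 𝔼 x : R → G, 𝔼 y : L → G, (Fintype.card G : ℝ)⁻¹ := by
    simp only [Fintype.expect_const]
  conv_rhs => rw [hc]
  simp only [← expect_add_distrib]
  refine expect_congr rfl fun x _ => expect_congr rfl fun y _ => ?_
  simp only [indicator_mul_mul_eq_one, mul_add, Finset.sum_add_distrib, ← Finset.sum_mul,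
    sum_prod_noise, one_mul, Finset.mul_sum]
  congr 1
  rw [Finset.sum_comm]
  refine Finset.sum_congr rfl fun a _ => ?_
  rw [Finset.sum_comm]

/-- Soundness of the test for a smooth UFG Label Cover. -/
theorem test_opt_le [Fintype V] [Fintype W] [Nonempty L] [Nonempty R]
    (Λ : UFGLabelCover V W E L R r m) (hgood : ∀ w, ∃ d, Λ.Good w d)
    {ε τ ζ ρ : ℝ} (hε₀ : 0 ≤ ε) (hε₁ : ε ≤ 1) (hτ : 0 ≤ τ) (hΛ : Λ.Smooth τ) (hζ : 0 < ζ)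
    (hρ₀ : 0 ≤ ρ) (hρ : ∀ k : ℕ, ζ < k → (1 - ε) ^ k ≤ ρ) :
    (Λ.test G ε hε₀ hε₁).opt ≤ (Fintype.card G : ℝ)⁻¹ +
      (Fintype.card G : ℝ) ^ 2 * (ρ + ζ * τ + √(ζ * Λ.opt)) := by
  have hE := Λ.edge_nonempty
  refine ciSup_le fun A => ?_
  rw [test_value_eq]
  simp only [expect_test_indicator_eq, expect_add_distrib, Fintype.expect_const]
  refine add_le_add_right ?_ _
  rw [Finset.expect_sum_comm]
  simp only [Finset.expect_sum_comm _ (Finset.univ : Finset G)]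
  have h (a b : G) := expect_sum_correlation_le Λ
    (f := fun w x => centredIndicator a (Λ.functionalTable A w x))
    (g := fun w z => indicator b (A (Query.unfolded w z)))
    (h := fun v y => centredIndicator (a * b)⁻¹ (Λ.classicalTable A v y))
    (fun _ _ => abs_centredIndicator_le_one _ _) (fun _ _ => abs_indicator_le_one _ _)
    (fun _ _ => abs_centredIndicator_le_one _ _)
    (fun w S hS => Λ.energy_centredIndicator_functionalTable hgood A w a S hS)
    hε₀ hε₁ hτ hΛ hζ hρ₀ hρ
  refine (Finset.sum_le_sum fun a _ => Finset.sum_le_sum fun b _ => h a b).trans_eq ?_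
  simp only [Finset.sum_const, Finset.card_univ, nsmul_eq_mul]
  ring

/-- Completeness of the test. -/
theorem le_test_opt [Finite V] [Finite W] [Nonempty L] [Nonempty R]
    (Λ : UFGLabelCover V W E L R r m) (hΛ : Λ.opt = 1) {ε : ℝ} (hε₀ : 0 ≤ ε) (hε₁ : ε ≤ 1) :
    1 - ε ≤ (Λ.test G ε hε₀ hε₁).opt := by
  classical
  have hE := Λ.edge_nonempty
  obtain ⟨⟨σL, σR⟩, hσ⟩ :=
    exists_eq_ciSup_of_finite (f := fun σ : (V → L) × (W → R) => Λ.value σ.1 σ.2)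
  have hsat : ∀ e, Λ.Satisfies σL σR e := by
    have h1 : Λ.value σL σR = 1 := hσ.trans hΛ
    rw [value, div_eq_one_iff_eq (Nat.cast_ne_zero.mpr Fintype.card_ne_zero)] at h1
    have h2 := Finset.card_eq_iff_eq_univ _ |>.mp (Nat.cast_injective h1)
    exact fun e => (Finset.mem_filter.mp (h2 ▸ Finset.mem_univ e)).2
  let A : Query V W L R G Λ.p → G := fun
    | .functional w x => x.out (σR w)
    | .unfolded w z => z (σR w)
    | .classical v y => y.out (σL v)
  refine le_trans ?_ (Λ.test_value_le_opt hε₀ hε₁ A)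
  have hf (e : E) (x : R → G) : Λ.functionalTable A (Λ.right e) x = x (σR (Λ.right e)) := by
    have h := Classical.choose_spec (functional_out Λ.p x) (σR (Λ.right e))
    have hb : (fun i => Λ.b (Λ.idx (Λ.right e) i)) = fun i => Λ.p i (σR (Λ.right e)) :=
      funext fun i => ((hsat e).2 i).symm
    rw [functionalTable, hb, functionalFactor]
    exact h.symm
  have hc (v : V) (y : L → G) : Λ.classicalTable A v y = y (σL v) :=
    (Classical.choose_spec (classical_out y) (σL v)).symm
  have hind (e : E) (x : R → G) (y : L → G) (η : R → G) :
      indicator 1 (Λ.functionalTable A (Λ.right e) x *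
          A (Query.unfolded (Λ.right e) (fun d => (x d)⁻¹ * η d * (y (Λ.proj e d))⁻¹)) *
          Λ.classicalTable A (Λ.left e) y) = indicator 1 (η (σR (Λ.right e))) := by
    rw [hf, hc]
    simp only [A, (hsat e).1]
    -- The factors `x` and `y` cancel because `σL` agrees with the projection of `σR`; only the
    -- noise at one coordinate remains.
    group
  rw [test_value_eq]
  simp only [hind]
  refine Finset.le_expect Finset.univ_nonempty fun e _ => ?_
  simp only [Fintype.expect_const]
  set d₀ := σR (Λ.right e)
  have : ∑ η : R → G, (∏ d, noise ε (η d)) * indicator 1 (η d₀) = noise ε (1 : G) := by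
    have h1 (η : R → G) : (∏ d, noise ε (η d)) * indicator 1 (η d₀) =
        ∏ d, noise ε (η d) * (if d = d₀ then indicator 1 (η d) else 1) := by
      rw [Finset.prod_mul_distrib, Finset.prod_ite_eq' Finset.univ d₀, if_pos (Finset.mem_univ _)]
    simp only [h1]
    rw [← Fintype.prod_sum fun (d : R) (g : G) =>
      noise ε g * (if d = d₀ then indicator 1 g else 1), Fintype.prod_eq_single d₀]
    · simp [indicator]
    · intro d hd
      simp [hd, noise_sum]
  rw [this, noise, if_pos rfl, mul_one]
  exact le_add_of_nonneg_right (div_nonneg hε₀ (Nat.cast_nonneg _))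

end UFGLabelCover

/-! ### Smoothness of smooth parallel repetition -/

theorem Positions.mem_of_ne_rest {r t : ℕ} (T : Positions r t) {j : Fin r}
    (hj : ∀ k, T.rest k ≠ j) : j ∈ T.1 := by
  by_contra h
  have : j ∈ Set.range T.rest := by
    simp [Positions.rest, Finset.range_orderEmbOfFin, h]
  obtain ⟨k, hk⟩ := this
  exact hj k hk

theorem Positions.nonempty {r t : ℕ} (htr : t ≤ r) : Nonempty (Positions r t) := by
  obtain ⟨T, -, hT⟩ := Finset.exists_subset_card_eq
    (s := (Finset.univ : Finset (Fin r))) (n := t) (by simpa)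
  exact ⟨⟨T, hT⟩⟩

theorem Positions.expect_mem {r t : ℕ} (ht : 0 < t) (htr : t ≤ r) (j : Fin r) :
    𝔼 T : Positions r t, (if j ∈ T.1 then (1 : ℝ) else 0) = t / r := by
  have h1 (f : Finset (Fin r) → ℝ) :
      ∑ T : Positions r t, f T.1 = ∑ T ∈ Finset.powersetCard t Finset.univ, f T :=
    (Finset.sum_subtype _ (fun T => by simp [Finset.mem_powersetCard]) f).symm
  have hcard : (Fintype.card (Positions r t) : ℝ) = r.choose t := by simp
  rw [Fintype.expect_eq_sum_div_card, h1 fun T => if j ∈ T then 1 else 0, hcard,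
    Finset.sum_boole]
  have h2 := Finset.card_filter_powersetCard_subset {j} (Finset.univ : Finset (Fin r)) t
    (Finset.subset_univ _) (by simpa using Nat.succ_le_of_lt ht)
  simp only [Finset.singleton_subset_iff, Finset.card_univ, Fintype.card_fin,
    Finset.card_singleton] at h2
  rw [h2]
  obtain ⟨t, rfl⟩ := Nat.exists_eq_add_of_lt ht
  obtain ⟨r, rfl⟩ := Nat.exists_eq_add_of_lt (ht.trans_le htr)
  simp only [zero_add, Nat.add_sub_cancel] at htr ⊢
  have h3 : ((r + 1 : ℕ) : ℝ) * r.choose t = (r + 1).choose (t + 1) * (t + 1 : ℕ) := by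
    exact_mod_cast Nat.add_one_mul_choose_eq r t
  have h4 : ((r + 1).choose (t + 1) : ℝ) ≠ 0 :=
    Nat.cast_ne_zero.mpr (Nat.choose_pos htr).ne'
  have h5 : ((r + 1 : ℕ) : ℝ) ≠ 0 := Nat.cast_ne_zero.mpr (Nat.succ_ne_zero r)
  rw [div_eq_div_iff h4 h5]
  linarith

theorem MaxTSA.smooth_smoothRepetition {n m : ℕ} (Φ : MaxTSA n m) (hm : 0 < m) {r t : ℕ}
    (ht : 0 < t) (htr : t ≤ r) :
    (Φ.smoothRepetition hm htr).Smooth ((t : ℝ) / r) := by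
  have hT := Positions.nonempty htr
  have hw : Nonempty (RightVertex m r) := ⟨fun _ => ⟨0, hm⟩⟩
  intro φ hφ d d'
  have hE (F : SmoothEdge m r t → ℝ) : 𝔼 e, F e =
      𝔼 w, 𝔼 T : Positions r t, 𝔼 c, F (w, T, c) := by
    rw [← Finset.univ_product_univ, Finset.expect_product]
    refine expect_congr rfl fun w _ => ?_
    rw [← Finset.univ_product_univ, Finset.expect_product]
  rw [hE, hE]
  simp only [show ∀ e, (Φ.smoothRepetition hm htr).right e = e.1 from fun _ => rfl,
    Fintype.expect_const]
  rw [mul_expect]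
  refine Finset.expect_le_expect fun w _ => ?_
  simp only [← mul_expect]
  rw [mul_comm]
  refine mul_le_mul_of_nonneg_right ?_ (hφ w)
  -- Two distinct labels differ in some block `j`. A position that is not chosen keeps its whole
  -- block, so a collision forces `j` to be chosen.
  by_cases hd : d w = d' w
  · simp only [hd, ne_eq, not_true_eq_false, false_and, if_false, Fintype.expect_const]
    positivity
  · obtain ⟨j, hj⟩ := Function.ne_iff.mp hd
    rw [← Positions.expect_mem ht htr j]
    refine Finset.expect_le_expect fun T _ =>
      Finset.expect_le Finset.univ_nonempty fun c _ => ?_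
    by_cases hjT : j ∈ T.1
    · rw [if_pos hjT]
      split_ifs <;> norm_num
    · rw [if_neg hjT, if_neg]
      rintro ⟨-, h⟩
      refine hjT (T.mem_of_ne_rest fun k hk => hj ?_)
      have : d w (T.rest k) = d' w (T.rest k) := congrFun (congrArg Prod.snd h) k
      rwa [hk] at this

theorem MaxTSA.exists_good_smoothRepetition {n m : ℕ} (Φ : MaxTSA n m) (hm : 0 < m) {r t : ℕ}
    (htr : t ≤ r) (w : RightVertex m r) : ∃ d, (Φ.smoothRepetition hm htr).Good w d := by
  refine ⟨fun j => ![Φ.b (w j), 0, 0, 0, 0], fun j => ?_⟩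
  simp [MaxTSA.smoothRepetition, tsa]

end UFG

/-! ### Choice of parameters -/

theorem mainTheorem3 {G : Type*} [Group G] [Fintype G]
    {n m : ℕ} (hm : 0 < m) (Φ : UFG.MaxTSA n m) (r t : ℕ) (ht : 1 < t) (htr : t < r)
    (ε δ ζ : ℝ) (hε₀ : 0 < ε) (hε₁ : ε ≤ 1) (hδ : 0 < δ)
    (hζ : ζ = Real.log (2 * (Fintype.card G : ℝ) ^ 3 / δ) / ε)
    (hrt : (t : ℝ) / (r : ℝ) ≤ δ ^ 2 / (4 * (Fintype.card G : ℝ) ^ 6 * ζ ^ 2)) :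
    ((Φ.smoothRepetition hm htr.le).opt = 1 →
      1 - ε ≤ ((Φ.smoothRepetition hm htr.le).test G ε hε₀.le hε₁).opt) ∧
    ((Φ.smoothRepetition hm htr.le).opt ≤ δ ^ 4 / (32 * (Fintype.card G : ℝ) ^ 12) * ζ⁻¹ →
      ((Φ.smoothRepetition hm htr.le).test G ε hε₀.le hε₁).opt ≤
        1 / (Fintype.card G : ℝ) + δ) := by
  refine ⟨fun h => UFG.UFGLabelCover.le_test_opt _ h _ _, fun hopt => ?_⟩
  set N : ℝ := (Fintype.card G : ℝ) with hN
  have hN1 : 1 ≤ N := by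
    rw [hN]
    exact_mod_cast Nat.one_le_iff_ne_zero.mpr (Fintype.card_ne_zero (α := G))
  -- Otherwise `N ≥ 2` and `δ < 1`, which makes the logarithm, and hence `ζ`, at least one.
  by_cases htriv : 1 ≤ 1 / N + δ
  · refine le_trans (ciSup_le fun A => ?_) htriv
    exact UFG.UFGLabelCover.test_value_le_one _ _ _ A
  push Not at htriv
  have hN2 : 2 ≤ N := by
    have : Fintype.card G ≠ 1 := by
      intro h1
      rw [hN, h1, Nat.cast_one] at htriv
      linarith
    have h0 : Fintype.card G ≠ 0 := Fintype.card_ne_zero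
    rw [hN]
    exact_mod_cast (by omega : 2 ≤ Fintype.card G)
  have hδ1 : δ < 1 := by
    have : 0 < 1 / N := by positivity
    linarith
  have hN3 : (8 : ℝ) ≤ N ^ 3 := by
    calc (8 : ℝ) = 2 ^ 3 := by norm_num
      _ ≤ N ^ 3 := pow_le_pow_left₀ (by norm_num) hN2 3
  have hlog : 1 ≤ Real.log (2 * N ^ 3 / δ) := by
    rw [Real.le_log_iff_exp_le (by positivity), le_div_iff₀ hδ]
    have := Real.exp_one_lt_d9
    nlinarith [Real.exp_pos 1]
  have hζ1 : 1 ≤ ζ := by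
    rw [hζ, le_div_iff₀ hε₀]
    linarith
  -- `ζ` is chosen so that `exp (-ε ζ) = δ / (2 N³)`.
  have hρ (k : ℕ) (hk : ζ < k) : (1 - ε) ^ k ≤ δ / (2 * N ^ 3) := by
    have h1 : (1 - ε) ^ k ≤ Real.exp (-ε) ^ k :=
      pow_le_pow_left₀ (by linarith) (by linarith [Real.add_one_le_exp (-ε)]) k
    refine h1.trans ?_
    rw [← Real.exp_nat_mul, ← Real.le_log_iff_exp_le (by positivity), ← inv_div, Real.log_inv]
    have : Real.log (2 * N ^ 3 / δ) = ζ * ε := by rw [hζ]; field_simp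
    rw [this]
    nlinarith
  have hnL : Nonempty (UFG.LeftLabel r t) := ⟨fun _ => 0, fun _ _ => 0⟩
  have hmain := UFG.UFGLabelCover.test_opt_le (G := G) (Φ.smoothRepetition hm htr.le)
    (Φ.exists_good_smoothRepetition hm htr.le) hε₀.le hε₁ (by positivity)
    (Φ.smooth_smoothRepetition hm (by omega) htr.le) (by linarith : 0 < ζ)
    (by positivity : 0 ≤ δ / (2 * N ^ 3)) hρ
  refine hmain.trans ?_
  rw [one_div]
  refine add_le_add_right ?_ _
  have hN0 : 0 < N := by linarith
  have hζ0 : 0 < ζ := by linarith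
  -- Each of the three error terms, multiplied by the number `N²` of pairs `(a, b)`, is at most `δ /
  -- 4`.
  have h1 : N ^ 2 * (δ / (2 * N ^ 3)) ≤ δ / 4 := by
    have : N ^ 2 * (δ / (2 * N ^ 3)) = δ / (2 * N) := by field_simp
    rw [this]
    exact div_le_div_of_nonneg_left hδ.le (by norm_num) (by linarith)
  have hN4 : 16 ≤ N ^ 4 := by
    calc (16 : ℝ) = 2 ^ 4 := by norm_num
      _ ≤ N ^ 4 := pow_le_pow_left₀ (by norm_num) hN2 4
  have hδsq : δ ^ 2 ≤ δ := by nlinarith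
  have h2 : N ^ 2 * (ζ * ((t : ℝ) / r)) ≤ δ / 4 := by
    calc N ^ 2 * (ζ * ((t : ℝ) / r))
        ≤ N ^ 2 * (ζ * (δ ^ 2 / (4 * N ^ 6 * ζ ^ 2))) := by gcongr
      _ = δ ^ 2 / (4 * N ^ 4 * ζ) := by field_simp
      _ ≤ δ / 4 := by
        refine div_le_div₀ hδ.le hδsq (by norm_num) ?_
        nlinarith
  have h3 : N ^ 2 * √(ζ * (Φ.smoothRepetition hm htr.le).opt) ≤ δ / 4 := by
    have hs : √(ζ * (Φ.smoothRepetition hm htr.le).opt) ≤ δ ^ 2 / (4 * N ^ 6) := by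
      refine Real.sqrt_le_iff.mpr ⟨by positivity, ?_⟩
      calc ζ * (Φ.smoothRepetition hm htr.le).opt
          ≤ ζ * (δ ^ 4 / (32 * N ^ 12) * ζ⁻¹) := by gcongr
        _ = δ ^ 4 / (32 * N ^ 12) := by field_simp
        _ ≤ δ ^ 4 / (16 * N ^ 12) := by gcongr; norm_num
        _ = (δ ^ 2 / (4 * N ^ 6)) ^ 2 := by field_simp; norm_num
    calc N ^ 2 * √(ζ * (Φ.smoothRepetition hm htr.le).opt)
        ≤ N ^ 2 * (δ ^ 2 / (4 * N ^ 6)) := by gcongr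
      _ = δ ^ 2 / (4 * N ^ 4) := by field_simp
      _ ≤ δ / 4 := div_le_div₀ hδ.le hδsq (by norm_num) (by linarith)
  rw [mul_add, mul_add]
  linarith
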